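/- Let $N\ge 3$ be an integer, $\mu_0=-\frac{(N-2)^2}{4}$, and let $\Omega\subset\mathbb R^N$ be a bounded domain containing the origin. For $\mu\ge\mu_0$ put $\mathcal L_\mu=-\Delta+\mu|x|^{-2}$ and $\tau_+(\mu)=-\frac{N-2}{2}+\sqrt{\mu-\mu_0}$. Let $\mu_0\le\mu_1<0\le\mu_2$ (so $\tau_+(\mu_1)<0$) and let $p,q>0$ be real numbers. Assume that one of the following holds: (i) $q\ge \frac{N+\tau_+(\mu_2)}{-\tau_+(\mu_1)}$; (ii) $\frac{2}{-\tau_+(\mu_1)}<q<\frac{N+\tau_+(\mu_2)}{-\tau_+(\mu_1)}$, and $\tau_+(\mu_1)(pq-1)+2p+2<0$ if $\mu_1>\mu_0$, respectively $\tau_+(\mu_1)(pq-1)+2p+2\le 0$ if $\mu_1=\mu_0$. Then the system $\mathcal L_{\mu_1}u=v^p$, $\mathcal L_{\mu_2}v=u^q$ in $\Omega\setminus\{0\}$ has no positive supersolution, that is, there are no functions $u,v\in C^2(\Omega\setminus\{0\})$ with $u>0$, $v>0$ and $$\mathcal L_{\mu_1}u(x)\ge v(x)^p,\qquad \mathcal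 L_{\mu_2}v(x)\ge u(x)^q\qquad\text{for every }x\in\Omega\setminus\{0\}.$$ -/

import Mathlib

/-- The critical Hardy coefficient `μ₀ = -(N-2)²/4`. -/
noncomputable def hardyMuZero (N : ℕ) : ℝ := -((N : ℝ) - 2) ^ 2 / 4

/-- `τ₊(μ) = -(N-2)/2 + √(μ - μ₀)`, used for `μ ≥ μ₀` only: the larger root of
`μ - τ (τ + N - 2) = 0`. -/
noncomputable def hardyTauPlus (N : ℕ) (μ : ℝ) : ℝ :=
  -((N : ℝ) - 2) / 2 + Real.sqrt (μ - hardyMuZero N)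

/-- The Hardy operator `ℒ_μ w (x) = -Δ w (x) + μ |x|⁻² w (x)`, evaluated pointwise
(used only at points `x ≠ 0` near which `w` is of class `C²`). -/
noncomputable def hardyOp {N : ℕ} (μ : ℝ) (w : EuclideanSpace ℝ (Fin N) → ℝ)
    (x : EuclideanSpace ℝ (Fin N)) : ℝ :=
  -(Laplacian.laplacian w x) + μ / ‖x‖ ^ 2 * w x

/-- `(u, v)` is a positive (classical) supersolution of the Lane-Emden system
`ℒ_{μ₁} u = v ^ p`, `ℒ_{μ₂} v = u ^ q` in `Ω ∖ {0}`: both functions are of class `C²` and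
positive there, and the two inequalities hold at every point. No condition is imposed at the
origin, on the boundary of `Ω`, or outside `Ω`. -/
structure IsPositiveSupersolution {N : ℕ} (Ω : Set (EuclideanSpace ℝ (Fin N)))
    (μ₁ μ₂ p q : ℝ) (u v : EuclideanSpace ℝ (Fin N) → ℝ) : Prop where
  contDiffOn_u : ContDiffOn ℝ 2 u (Ω \ {0})
  contDiffOn_v : ContDiffOn ℝ 2 v (Ω \ {0})
  pos_u : ∀ x ∈ Ω \ {0}, 0 < u x
  pos_v : ∀ x ∈ Ω \ {0}, 0 < v x
  ineq_u : ∀ x ∈ Ω \ {0}, v x ^ p ≤ hardyOp μ₁ u x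
  ineq_v : ∀ x ∈ Ω \ {0}, u x ^ q ≤ hardyOp μ₂ v x

/-!
Write `t = log |x|`. On radial functions `|x| ^ τ g (t)` the operator `|x|² ℒ_μ` acts as an ordinary
differential operator with constant coefficients, whose characteristic roots are
`τ₋(μ) ≤ τ₊(μ)`. A positive `w` with `ℒ_μ w > 0` dominates every radial barrier `ψ` that is
nonpositive near the origin, lies below `w` on a sphere, and satisfies `ℒ_μ ψ ≤ ℒ_μ w`: look at a
maximum point of `ψ / w` (`IsStrictSupersolution.comparison`). Explicit barriers then give three
facts about such a `w` near the origin.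

* `w ≥ c |x| ^ τ₊(μ)` (`IsStrictSupersolution.hasPowerLowerBound_root`).
* If `ℒ_μ w ≥ a |x| ^ (β - 2)` with `τ₋(μ) < β < τ₊(μ)`, then `w ≥ c |x| ^ β`
  (`IsStrictSupersolution.hasPowerLowerBound_of_source`).
* If `ℒ_μ w ≥ a |x| ^ (β - 2)`, then `β > τ₋(μ)` (`IsStrictSupersolution.false_of_source`).

Since both right-hand sides are positive, `u` and `v` are such functions. From
`u ≥ c |x| ^ τ₊(μ₁)` one gets `ℒ_{μ₂} v ≥ c |x| ^ (q τ₊(μ₁))`, which the third fact excludes when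
`q` is large, as `τ₋(μ₂) = 2 - N - τ₊(μ₂)`. Otherwise the second fact turns a bound
`u ≥ c |x| ^ β` with `β ≤ τ₊(μ₁)` into `v ≥ c |x| ^ (q β + 2)`, and that into
`u ≥ c |x| ^ (p q β + 2 p + 2)`. When `μ₁ = μ₀` the two roots coincide and the new exponent is
already excluded; when `μ₁ > μ₀` it is smaller than `β` by a fixed amount, so iteration drives it
below `τ₋(μ₁)`, which is impossible.
-/

open Filter Topology
open scoped RealInnerProductSpace

/-! ### The Laplacian at a local maximum and on radial functions -/

/-- Otherwise the second derivative test makes `a` a local minimum as well, so that `f` is constant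
near `a`. -/
theorem IsLocalMax.deriv_deriv_nonpos {f : ℝ → ℝ} {a : ℝ} (h : IsLocalMax f a)
    (hc : ContinuousAt f a) : deriv (deriv f) a ≤ 0 := by
  by_contra! hpos
  have hmin : IsLocalMin f a := isLocalMin_of_deriv_deriv_pos hpos h.deriv_eq_zero hc
  have hconst : f =ᶠ[𝓝 a] fun _ => f a := by
    filter_upwards [h, hmin] with y h1 h2 using le_antisymm h1 h2
  have h2 : deriv (deriv f) a = 0 := by
    rw [hconst.deriv.deriv_eq]
    simp
  linarith

/-- The diagonal of the second differential is the second derivative along a line. -/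
theorem iteratedFDeriv_two_eq_deriv_deriv {E : Type*} [NormedAddCommGroup E] [NormedSpace ℝ E]
    {f : E → ℝ} {x : E} (hf : ContDiffAt ℝ 2 f x) (v : E) :
    iteratedFDeriv ℝ 2 f x ![v, v] = deriv (deriv fun t : ℝ => f (x + t • v)) 0 := by
  have hline : ∀ t : ℝ, HasDerivAt (fun t : ℝ => x + t • v) v t := fun t => by
    simpa using ((hasDerivAt_id t).smul_const v).const_add x
  have hx : x + (0 : ℝ) • v = x := by simp
  have htend : Tendsto (fun t : ℝ => x + t • v) (𝓝 0) (𝓝 x) := by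
    have := (hline 0).continuousAt.tendsto
    rwa [hx] at this
  have h1 : deriv (fun t : ℝ => f (x + t • v)) =ᶠ[𝓝 0] fun t => fderiv ℝ f (x + t • v) v := by
    have hd : ∀ᶠ y in 𝓝 x, DifferentiableAt ℝ f y :=
      (hf.eventually (by simp)).mono fun y hy => hy.differentiableAt (by simp)
    filter_upwards [htend.eventually hd] with t ht
    exact (ht.hasFDerivAt.comp_hasDerivAt t (hline t)).deriv
  have h2 : HasFDerivAt (fderiv ℝ f) (fderiv ℝ (fderiv ℝ f) x) (x + (0 : ℝ) • v) := by
    rw [hx]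
    exact ((hf.fderiv_right (m := 1) (by norm_num)).differentiableAt (by simp)).hasFDerivAt
  have h3 : HasDerivAt (fun t : ℝ => fderiv ℝ f (x + t • v)) (fderiv ℝ (fderiv ℝ f) x v) 0 :=
    h2.comp_hasDerivAt (0 : ℝ) (hline 0)
  have h4 : HasDerivAt (fun t : ℝ => fderiv ℝ f (x + t • v) v)
      (fderiv ℝ (fderiv ℝ f) x v v) 0 :=
    (ContinuousLinearMap.apply ℝ ℝ v).hasFDerivAt.comp_hasDerivAt (0 : ℝ) h3
  rw [h1.deriv_eq, h4.deriv, iteratedFDeriv_two_apply]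
  rfl

theorem IsLocalMax.laplacian_nonpos {N : ℕ} {f : EuclideanSpace ℝ (Fin N) → ℝ}
    {x : EuclideanSpace ℝ (Fin N)} (h : IsLocalMax f x) (hf : ContDiffAt ℝ 2 f x) :
    Laplacian.laplacian f x ≤ 0 := by
  rw [InnerProductSpace.laplacian_eq_iteratedFDeriv_orthonormalBasis f
    (EuclideanSpace.basisFun (Fin N) ℝ)]
  refine Finset.sum_nonpos fun i _ => ?_
  rw [iteratedFDeriv_two_eq_deriv_deriv hf]
  set v := EuclideanSpace.basisFun (Fin N) ℝ i
  have hc : ContinuousAt (fun t : ℝ => x + t • v) 0 := by fun_prop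
  have hx : x + (0 : ℝ) • v = x := by simp
  refine IsLocalMax.deriv_deriv_nonpos ?_ ?_
  · have htend : Tendsto (fun t : ℝ => x + t • v) (𝓝 0) (𝓝 x) := by
      have := hc.tendsto
      rwa [hx] at this
    have := htend.eventually h
    rwa [IsLocalMax, IsMaxFilter, hx]
  · exact ContinuousAt.comp' (by rw [hx]; exact hf.continuousAt) hc

theorem contDiffAt_comp_log_norm {N : ℕ} {G : ℝ → ℝ} (hG : ContDiff ℝ 2 G)
    {x : EuclideanSpace ℝ (Fin N)} (hx : x ≠ 0) :
    ContDiffAt ℝ 2 (fun y => G (Real.log ‖y‖)) x :=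
  hG.contDiffAt.comp x ((contDiffAt_norm ℝ hx).log (norm_ne_zero_iff.2 hx))

/-- In the variable `t = log |x|`, the radial Laplacian is `|x|⁻² (∂ₜ² + (N - 2) ∂ₜ)`, with constant
coefficients. -/
theorem laplacian_comp_log_norm {N : ℕ} {G G₁ G₂ : ℝ → ℝ} (hG : ContDiff ℝ 2 G)
    (h₁ : ∀ t, HasDerivAt G (G₁ t) t) (h₂ : ∀ t, HasDerivAt G₁ (G₂ t) t)
    {x : EuclideanSpace ℝ (Fin N)} (hx : x ≠ 0) :
    ‖x‖ ^ 2 * (Laplacian.laplacian fun y : EuclideanSpace ℝ (Fin N) => G (Real.log ‖y‖)) x =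
      G₂ (Real.log ‖x‖) + ((N : ℝ) - 2) * G₁ (Real.log ‖x‖) := by
  have hn : ‖x‖ ≠ 0 := norm_ne_zero_iff.2 hx
  have key : ∀ v : EuclideanSpace ℝ (Fin N), ‖v‖ = 1 →
      deriv (deriv fun t : ℝ => G (Real.log ‖x + t • v‖)) 0 =
        G₂ (Real.log ‖x‖) * ⟪x, v⟫ ^ 2 / ‖x‖ ^ 4 +
          G₁ (Real.log ‖x‖) * (1 / ‖x‖ ^ 2 - 2 * ⟪x, v⟫ ^ 2 / ‖x‖ ^ 4) := by
    intro v hv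
    set a := ⟪x, v⟫ with ha
    set s : ℝ → ℝ := fun t => ‖x‖ ^ 2 + 2 * a * t + t ^ 2 with hs
    -- `s t` is `‖x + t • v‖ ^ 2`; the square avoids differentiating the norm itself.
    have hnorm : ∀ t : ℝ, Real.log ‖x + t • v‖ = Real.log (s t) / 2 := by
      intro t
      have : s t = ‖x + t • v‖ ^ 2 := by
        rw [norm_add_sq_real, inner_smul_right, norm_smul, hv, hs]
        simp only [Real.norm_eq_abs, mul_one, sq_abs]
        ring
      rw [this, Real.log_pow]
      push_cast
      ring
    have hs' : ∀ t, HasDerivAt s (2 * a + 2 * t) t := fun t => by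
      have h := (((hasDerivAt_id' t).const_mul (2 * a)).const_add (‖x‖ ^ 2)).add
        (hasDerivAt_pow 2 t)
      refine (h.congr_deriv ?_ : HasDerivAt s _ t)
      simp
    have hs0 : s 0 = ‖x‖ ^ 2 := by simp [hs]
    have hs0' : s 0 ≠ 0 := by rw [hs0]; positivity
    have hne : ∀ᶠ t in 𝓝 (0 : ℝ), s t ≠ 0 := (hs' 0).continuousAt.eventually_ne hs0'
    have hl : ∀ t, s t ≠ 0 →
        HasDerivAt (fun t => Real.log (s t) / 2) ((a + t) / s t) t := fun t ht => by
      have h := ((hs' t).log ht).div_const 2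
      rwa [show (2 * a + 2 * t) / s t / 2 = (a + t) / s t by ring] at h
    have hd1 : deriv (fun t : ℝ => G (Real.log ‖x + t • v‖)) =ᶠ[𝓝 0]
        fun t => G₁ (Real.log (s t) / 2) * ((a + t) / s t) := by
      filter_upwards [hne] with t ht
      simp only [hnorm]
      exact ((h₁ _).comp t (hl t ht)).deriv
    have hd2 : HasDerivAt (fun t => G₁ (Real.log (s t) / 2) * ((a + t) / s t))
        (G₂ (Real.log (s 0) / 2) * ((a + 0) / s 0) * ((a + 0) / s 0) +
          G₁ (Real.log (s 0) / 2) * ((1 * s 0 - (a + 0) * (2 * a + 2 * 0)) / s 0 ^ 2)) 0 :=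
      ((h₂ (Real.log (s 0) / 2)).comp (0 : ℝ) (hl 0 hs0')).mul
        (((hasDerivAt_id' (0 : ℝ)).const_add a).div (hs' 0) hs0')
    have hlog : Real.log (s 0) / 2 = Real.log ‖x‖ := by
      rw [← hnorm, zero_smul, add_zero]
    rw [hd1.deriv_eq, hd2.deriv, hlog, hs0]
    field_simp
    ring
  have hsum : ∑ i, ⟪x, EuclideanSpace.basisFun (Fin N) ℝ i⟫ ^ 2 = ‖x‖ ^ 2 :=
    OrthonormalBasis.sum_sq_inner_left _ _
  rw [InnerProductSpace.laplacian_eq_iteratedFDeriv_orthonormalBasis _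
    (EuclideanSpace.basisFun (Fin N) ℝ)]
  simp only [iteratedFDeriv_two_eq_deriv_deriv (contDiffAt_comp_log_norm hG hx)]
  rw [Finset.sum_congr rfl fun i _ => key _ (by simp)]
  simp only [Finset.sum_add_distrib, ← Finset.sum_div, ← Finset.mul_sum, Finset.sum_sub_distrib,
    hsum, Finset.sum_const, Finset.card_univ, Fintype.card_fin, nsmul_eq_mul]
  field_simp

/-! ### Comparison with radial barriers -/

/-- A strict positive supersolution of `ℒ_μ` near the origin: `w` is of class `C²`, positive, and
satisfies `ℒ_μ w > 0` on the punctured closed ball `0 < |x| ≤ R`, where `R > 0`. -/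
structure IsStrictSupersolution {N : ℕ} (μ R : ℝ) (w : EuclideanSpace ℝ (Fin N) → ℝ) : Prop where
  radius_pos : 0 < R
  contDiffAt : ∀ x, x ≠ 0 → ‖x‖ ≤ R → ContDiffAt ℝ 2 w x
  pos : ∀ x, x ≠ 0 → ‖x‖ ≤ R → 0 < w x
  hardyOp_pos : ∀ x, x ≠ 0 → ‖x‖ ≤ R → 0 < hardyOp μ w x

/-- `ℒ_μ` applied to `|x| ^ τ g (log |x|)`. The coefficient of `g` vanishes when `τ` is a root of
`μ - τ (τ + N - 2) = 0`. -/
theorem norm_sq_mul_hardyOp_radial {N : ℕ} (μ τ : ℝ) {g g₁ g₂ : ℝ → ℝ} (hg : ContDiff ℝ 2 g)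
    (h₁ : ∀ t, HasDerivAt g (g₁ t) t) (h₂ : ∀ t, HasDerivAt g₁ (g₂ t) t)
    {x : EuclideanSpace ℝ (Fin N)} (hx : x ≠ 0) :
    ‖x‖ ^ 2 * hardyOp μ (fun y => Real.exp (τ * Real.log ‖y‖) * g (Real.log ‖y‖)) x =
      Real.exp (τ * Real.log ‖x‖) *
        ((μ - τ * (τ + ((N : ℝ) - 2))) * g (Real.log ‖x‖) -
          (2 * τ + ((N : ℝ) - 2)) * g₁ (Real.log ‖x‖) - g₂ (Real.log ‖x‖)) := by
  have hn : ‖x‖ ≠ 0 := norm_ne_zero_iff.2 hx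
  have he : ∀ t, HasDerivAt (fun t => Real.exp (τ * t)) (Real.exp (τ * t) * τ) t := fun t => by
    simpa using ((hasDerivAt_id' t).const_mul τ).exp
  have hG : ContDiff ℝ 2 fun t => Real.exp (τ * t) * g t := by fun_prop
  have hlap := laplacian_comp_log_norm hG (fun t => (he t).mul (h₁ t))
    (fun t => (((he t).mul_const τ).mul (h₁ t)).add ((he t).mul (h₂ t))) hx
  rw [hardyOp, mul_add, mul_neg, hlap]
  field_simp
  ring

theorem IsStrictSupersolution.exists_sphere_lower_bound {N : ℕ} {μ R : ℝ}
    {w : EuclideanSpace ℝ (Fin N) → ℝ} (hw : IsStrictSupersolution μ R w) :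
    ∃ m : ℝ, 0 < m ∧ ∀ x, ‖x‖ = R → m ≤ w x := by
  have hne : ∀ x : EuclideanSpace ℝ (Fin N), ‖x‖ = R → x ≠ 0 := by
    rintro x hx rfl
    rw [norm_zero] at hx
    exact hw.radius_pos.ne hx
  have hK : IsCompact (Metric.sphere (0 : EuclideanSpace ℝ (Fin N)) R) := isCompact_sphere 0 R
  rcases (Metric.sphere (0 : EuclideanSpace ℝ (Fin N)) R).eq_empty_or_nonempty with h | h
  · refine ⟨1, one_pos, fun x hx => ?_⟩
    have : x ∈ Metric.sphere (0 : EuclideanSpace ℝ (Fin N)) R := by simpa using hx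
    simp [h] at this
  · obtain ⟨x₀, hx₀, hmin⟩ := hK.exists_isMinOn h fun x hx => by
      have hx' : ‖x‖ = R := by simpa using hx
      exact (hw.contDiffAt x (hne x hx') hx'.le).continuousAt.continuousWithinAt
    have hx₀' : ‖x₀‖ = R := by simpa using hx₀
    exact ⟨w x₀, hw.pos x₀ (hne x₀ hx₀') hx₀'.le, fun x hx => hmin (by simpa using hx)⟩

/-- Comparison principle with the radial barrier `|x| ^ τ g (log |x|)`, which is nonpositive near
the origin, at most `w` on the sphere of radius `R`, and satisfies `ℒ_μ (barrier) ≤ ℒ_μ w`.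
Only the strict positivity of `w` and `ℒ_μ w` enters, so the sign of `μ` is irrelevant. -/
theorem IsStrictSupersolution.comparison {N : ℕ} {μ R : ℝ} {w : EuclideanSpace ℝ (Fin N) → ℝ}
    (hw : IsStrictSupersolution μ R w) (τ : ℝ) {g g₁ g₂ : ℝ → ℝ} {T : ℝ} (hg : ContDiff ℝ 2 g)
    (h₁ : ∀ t, HasDerivAt g (g₁ t) t) (h₂ : ∀ t, HasDerivAt g₁ (g₂ t) t)
    (hT : ∀ t ≤ T, g t ≤ 0)
    (hR : ∀ x, ‖x‖ = R → Real.exp (τ * Real.log ‖x‖) * g (Real.log ‖x‖) ≤ w x)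
    (hL : ∀ x, x ≠ 0 → ‖x‖ < R → Real.exp (τ * Real.log ‖x‖) *
        ((μ - τ * (τ + ((N : ℝ) - 2))) * g (Real.log ‖x‖) -
          (2 * τ + ((N : ℝ) - 2)) * g₁ (Real.log ‖x‖) - g₂ (Real.log ‖x‖)) ≤
      ‖x‖ ^ 2 * hardyOp μ w x)
    {x : EuclideanSpace ℝ (Fin N)} (hx : x ≠ 0) (hxR : ‖x‖ ≤ R) :
    Real.exp (τ * Real.log ‖x‖) * g (Real.log ‖x‖) ≤ w x := by
  set F : EuclideanSpace ℝ (Fin N) → ℝ :=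
    fun y => Real.exp (τ * Real.log ‖y‖) * g (Real.log ‖y‖) with hF
  have hFc : ∀ y, y ≠ 0 → ContDiffAt ℝ 2 F y := fun y hy =>
    contDiffAt_comp_log_norm (G := fun t => Real.exp (τ * t) * g t) (by fun_prop) hy
  change F x ≤ w x
  by_contra! hlt
  set K : Set (EuclideanSpace ℝ (Fin N)) := {y | Real.exp T ≤ ‖y‖ ∧ ‖y‖ ≤ R} with hKdef
  have hK0 : ∀ y ∈ K, y ≠ 0 := by
    rintro y hy rfl
    have := hy.1
    rw [norm_zero] at this
    exact (Real.exp_pos T).not_ge this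
  have hKc : IsCompact K := by
    refine (isCompact_closedBall (0 : EuclideanSpace ℝ (Fin N)) R).of_isClosed_subset ?_ ?_
    · exact (isClosed_le continuous_const continuous_norm).inter
        (isClosed_le continuous_norm continuous_const)
    · intro y hy
      simpa using hy.2
  have hin : ∀ y, y ≠ 0 → ‖y‖ ≤ Real.exp T → F y ≤ 0 := fun y hy hyT =>
    mul_nonpos_of_nonneg_of_nonpos (Real.exp_pos _).le
      (hT _ ((Real.log_le_iff_le_exp (norm_pos_iff.2 hy)).2 hyT))
  have hxK : x ∈ K := by
    refine ⟨?_, hxR⟩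
    by_contra! hxT
    linarith [hin x hx hxT.le, hw.pos x hx hxR]
  -- At a maximum point of `F / w` with value `s > 1`, the function `F - s w` has a local maximum
  -- equal to zero, so that `ℒ_μ F ≥ s ℒ_μ w > ℒ_μ w` there.
  obtain ⟨x₀, hx₀, hmax⟩ := hKc.exists_isMaxOn (f := fun y => F y / w y) ⟨x, hxK⟩ fun y hy =>
    ((hFc y (hK0 y hy)).continuousAt.div
      (hw.contDiffAt y (hK0 y hy) hy.2).continuousAt
      (hw.pos y (hK0 y hy) hy.2).ne').continuousWithinAt
  have hx₀0 := hK0 x₀ hx₀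
  have hw₀ := hw.pos x₀ hx₀0 hx₀.2
  set s := F x₀ / w x₀ with hs
  have hs1 : 1 < s :=
    lt_of_lt_of_le ((one_lt_div (hw.pos x hx hxR)).2 hlt) (hmax hxK)
  have hFs : F x₀ = s * w x₀ := by rw [hs]; field_simp
  have hFw : w x₀ < F x₀ := by rw [hFs]; nlinarith
  have hlo : Real.exp T < ‖x₀‖ := by
    by_contra! h
    linarith [hin x₀ hx₀0 h]
  have hhi : ‖x₀‖ < R := lt_of_le_of_ne hx₀.2 fun h => (hR x₀ h).not_gt hFw
  have hnhds : K ∈ 𝓝 x₀ := by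
    have h1 : ∀ᶠ y in 𝓝 x₀, Real.exp T < ‖y‖ := continuous_norm.continuousAt.eventually_const_lt hlo
    have h2 : ∀ᶠ y in 𝓝 x₀, ‖y‖ < R := continuous_norm.continuousAt.eventually_lt_const hhi
    filter_upwards [h1, h2] with y hy1 hy2 using ⟨hy1.le, hy2.le⟩
  have hwc := hw.contDiffAt x₀ hx₀0 hx₀.2
  have hswc : ContDiffAt ℝ 2 (s • w) x₀ := contDiffAt_const.smul hwc
  have hloc : IsLocalMax (F - s • w) x₀ := by
    filter_upwards [hnhds] with y hy
    have hle : F y / w y ≤ s := hmax hy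
    rw [div_le_iff₀ (hw.pos y (hK0 y hy) hy.2)] at hle
    simp only [Pi.sub_apply, Pi.smul_apply, smul_eq_mul, hFs]
    linarith
  have hlap := hloc.laplacian_nonpos ((hFc x₀ hx₀0).sub hswc)
  rw [(hFc x₀ hx₀0).laplacian_sub hswc, InnerProductSpace.laplacian_smul s hwc, smul_eq_mul] at hlap
  have hge : s * hardyOp μ w x₀ ≤ hardyOp μ F x₀ := by
    simp only [hardyOp, hFs]
    linarith
  have hle : hardyOp μ F x₀ ≤ hardyOp μ w x₀ := by
    have h := hL x₀ hx₀0 hhi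
    rw [← norm_sq_mul_hardyOp_radial μ τ hg h₁ h₂ hx₀0] at h
    exact le_of_mul_le_mul_left h (by have := norm_pos_iff.2 hx₀0; positivity)
  have := hw.hardyOp_pos x₀ hx₀0 hx₀.2
  nlinarith

/-! ### Behaviour of supersolutions near the origin -/

theorem le_of_forall_pos_add_mul_le {A B W : ℝ} (h : ∀ δ > 0, A + δ * B ≤ W) : A ≤ W := by
  have ht : Tendsto (fun δ : ℝ => A + δ * B) (𝓝[>] 0) (𝓝 (A + 0 * B)) :=
    ((by fun_prop : Continuous fun δ : ℝ => A + δ * B).tendsto 0).mono_left nhdsWithin_le_nhds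
  rw [zero_mul, add_zero] at ht
  exact le_of_tendsto ht (eventually_mem_nhdsWithin.mono h)

/-- `w ≥ c |x| ^ β` on the punctured closed ball of radius `R` for some `c > 0`; the power is
written as `exp (β log |x|)`. -/
def HasPowerLowerBound {N : ℕ} (R : ℝ) (w : EuclideanSpace ℝ (Fin N) → ℝ) (β : ℝ) : Prop :=
  ∃ c : ℝ, 0 < c ∧ ∀ x, x ≠ 0 → ‖x‖ ≤ R → c * Real.exp (β * Real.log ‖x‖) ≤ w x

/-- `w ≥ c |x| ^ τ` for the larger root `τ` of `μ - τ (τ + N - 2) = 0` (the hypothesis `hκ` singles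
it out). The barriers `c |x| ^ τ (1 + δ log (|x| / R))` serve the double root as well. -/
theorem IsStrictSupersolution.hasPowerLowerBound_root {N : ℕ} {μ R τ : ℝ}
    {w : EuclideanSpace ℝ (Fin N) → ℝ} (hw : IsStrictSupersolution μ R w)
    (hτ : τ * (τ + ((N : ℝ) - 2)) = μ) (hκ : 0 ≤ 2 * τ + ((N : ℝ) - 2)) :
    HasPowerLowerBound R w τ := by
  obtain ⟨m, hm, hmw⟩ := hw.exists_sphere_lower_bound
  set c := m / Real.exp (τ * Real.log R) with hc
  have hc0 : 0 < c := div_pos hm (Real.exp_pos _)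
  refine ⟨c, hc0, fun x hx hxR => le_of_forall_pos_add_mul_le
    (B := c * Real.exp (τ * Real.log ‖x‖) * (Real.log ‖x‖ - Real.log R)) fun δ hδ => ?_⟩
  have h1 : ∀ t, HasDerivAt (fun t => c * (1 + δ * (t - Real.log R))) (c * δ) t := fun t => by
    simpa using ((((hasDerivAt_id' t).sub_const (Real.log R)).const_mul δ).const_add 1).const_mul c
  have h := hw.comparison τ (T := Real.log R - 1 / δ) (by fun_prop) h1
    (fun t => hasDerivAt_const t (c * δ)) ?_ ?_ ?_ hx hxR
  · linarith
  · intro t ht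
    have h2 : δ * (t - Real.log R) ≤ δ * (-(1 / δ)) := by
      apply mul_le_mul_of_nonneg_left _ hδ.le
      linarith
    have h3 : δ * (-(1 / δ)) = -1 := by field_simp
    exact mul_nonpos_of_nonneg_of_nonpos hc0.le (by linarith)
  · intro y hy
    refine le_trans (le_of_eq ?_) (hmw y hy)
    rw [hy, hc]
    field_simp
    ring
  · intro y hy hyR
    have h2 := hw.hardyOp_pos y hy hyR.le
    refine le_trans ?_ (by positivity : 0 ≤ ‖y‖ ^ 2 * hardyOp μ w y)
    apply mul_nonpos_of_nonneg_of_nonpos (Real.exp_pos _).le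
    have : 0 ≤ (2 * τ + ((N : ℝ) - 2)) * (c * δ) := by positivity
    rw [hτ]
    linarith

/-- If `ℒ_μ w ≥ a |x| ^ (β - 2)` with `β` strictly between the two roots, then `w ≥ c |x| ^ β`: with
`η` so small that `β - η` is not below the smaller root, compare with
`c (|x| ^ β - δ |x| ^ (β - η))` and let `δ → 0`. -/
theorem IsStrictSupersolution.hasPowerLowerBound_of_source {N : ℕ} {μ R β a : ℝ}
    {w : EuclideanSpace ℝ (Fin N) → ℝ} (hw : IsStrictSupersolution μ R w)
    (hβ : β * (β + ((N : ℝ) - 2)) < μ) (ha : 0 < a)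
    (hsrc : ∀ x, x ≠ 0 → ‖x‖ ≤ R →
      a * Real.exp (β * Real.log ‖x‖) ≤ ‖x‖ ^ 2 * hardyOp μ w x) :
    HasPowerLowerBound R w β := by
  obtain ⟨m, hm, hmw⟩ := hw.exists_sphere_lower_bound
  set K := μ - β * (β + ((N : ℝ) - 2)) with hK
  have hK0 : 0 < K := sub_pos.2 hβ
  set b := 2 * β + ((N : ℝ) - 2) with hb
  -- The quantity `K + b η - η ^ 2` is the value of `μ - γ (γ + N - 2)` at `γ = β - η`.
  obtain ⟨η, hη0, hη⟩ : ∃ η : ℝ, 0 < η ∧ 0 ≤ K + b * η - η ^ 2 := by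
    refine ⟨min 1 (K / (|b| + 1)), by positivity, ?_⟩
    set η := min 1 (K / (|b| + 1))
    have h0 : 0 < η := by positivity
    have h1 : η ≤ 1 := min_le_left _ _
    have h2 : η * (|b| + 1) ≤ K := (le_div_iff₀ (by positivity)).1 (min_le_right _ _)
    nlinarith [neg_abs_le b]
  set c := min (m / Real.exp (β * Real.log R)) (a / K) with hc
  have hc0 : 0 < c := by positivity
  have hcm : Real.exp (β * Real.log R) * c ≤ m := by
    rw [mul_comm]
    exact (le_div_iff₀ (Real.exp_pos _)).1 (min_le_left _ _)
  have hcK : c * K ≤ a := (le_div_iff₀ hK0).1 (min_le_right _ _)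
  refine ⟨c, hc0, fun x hx hxR => le_of_forall_pos_add_mul_le
    (B := -(c * Real.exp (β * Real.log ‖x‖) * Real.exp (-η * Real.log ‖x‖))) fun δ hδ => ?_⟩
  have he : ∀ t, HasDerivAt (fun t => Real.exp (-η * t)) (Real.exp (-η * t) * -η) t := fun t => by
    simpa using ((hasDerivAt_id' t).const_mul (-η)).exp
  have h1 : ∀ t, HasDerivAt (fun t => c * (1 - δ * Real.exp (-η * t)))
      (c * -(δ * (Real.exp (-η * t) * -η))) t := fun t =>
    (((he t).const_mul δ).const_sub 1).const_mul c
  have h2 : ∀ t, HasDerivAt (fun t => c * -(δ * (Real.exp (-η * t) * -η)))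
      (c * -(δ * (Real.exp (-η * t) * -η * -η))) t := fun t =>
    ((((he t).mul_const (-η)).const_mul δ).neg).const_mul c
  have h := hw.comparison β (T := Real.log δ / η) (by fun_prop) h1 h2 ?_ ?_ ?_ hx hxR
  · linarith
  · intro t ht
    apply mul_nonpos_of_nonneg_of_nonpos hc0.le
    have h3 : -Real.log δ ≤ -η * t := by
      have := (le_div_iff₀ hη0).1 ht
      linarith
    have h4 := Real.exp_le_exp.2 h3
    rw [Real.exp_neg, Real.exp_log hδ] at h4
    have h5 := mul_le_mul_of_nonneg_left h4 hδ.le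
    rw [mul_inv_cancel₀ hδ.ne'] at h5
    linarith
  · intro y hy
    refine le_trans ?_ (hcm.trans (hmw y hy))
    rw [hy]
    apply mul_le_mul_of_nonneg_left _ (Real.exp_pos _).le
    have : 0 < c * (δ * Real.exp (-η * Real.log R)) := by positivity
    linarith
  · intro y hy hyR
    refine le_trans ?_ (hsrc y hy hyR.le)
    rw [mul_comm a]
    apply mul_le_mul_of_nonneg_left _ (Real.exp_pos _).le
    have h3 : 0 ≤ c * δ * Real.exp (-η * Real.log ‖y‖) * (K + b * η - η ^ 2) := by positivity
    linarith

/-- Nonexistence: a source `a |x| ^ (β - 2)` with `β` at most the smaller root `ρ` is too singular.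
Solutions of `ℒ_μ ψ = b |x| ^ (ρ - 2)` that vanish on the sphere `log |x| = s` and are nonpositive
for `log |x| ≤ s - S` serve as barriers; they can be chosen to grow linearly in `S` at a fixed
point. -/
theorem IsStrictSupersolution.false_of_source {N : ℕ} (hN : 0 < N) {μ R β ρ a : ℝ}
    {w : EuclideanSpace ℝ (Fin N) → ℝ} (hw : IsStrictSupersolution μ R w)
    (hρ : ρ * (ρ + ((N : ℝ) - 2)) = μ) (hκ : 2 * ρ + ((N : ℝ) - 2) ≤ 0) (hβ : β ≤ ρ) (ha : 0 < a)
    (hsrc : ∀ x, x ≠ 0 → ‖x‖ ≤ R →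
      a * Real.exp (β * Real.log ‖x‖) ≤ ‖x‖ ^ 2 * hardyOp μ w x) : False := by
  have hR := hw.radius_pos
  set s := Real.log R with hs
  set b := a * Real.exp ((β - ρ) * s) with hb
  have hb0 : 0 < b := by positivity
  obtain ⟨k, hk⟩ : ∃ k, k = -(2 * ρ + ((N : ℝ) - 2)) := ⟨_, rfl⟩
  have hk0 : 0 ≤ k := by linarith
  have hsrc' : ∀ x, x ≠ 0 → ‖x‖ < R →
      Real.exp (ρ * Real.log ‖x‖) * b ≤ ‖x‖ ^ 2 * hardyOp μ w x := by
    intro x hx hxR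
    refine le_trans ?_ (hsrc x hx hxR.le)
    have hlog : Real.log ‖x‖ ≤ s := Real.log_le_log (norm_pos_iff.2 hx) hxR.le
    have : ρ * Real.log ‖x‖ + (β - ρ) * s ≤ β * Real.log ‖x‖ := by nlinarith
    calc Real.exp (ρ * Real.log ‖x‖) * b = a * Real.exp (ρ * Real.log ‖x‖ + (β - ρ) * s) := by
          rw [hb, Real.exp_add]; ring
      _ ≤ a * Real.exp (β * Real.log ‖x‖) := by gcongr
  have : Nonempty (Fin N) := ⟨⟨0, hN⟩⟩
  obtain ⟨x₁, hx₁⟩ := exists_norm_eq (EuclideanSpace ℝ (Fin N)) (Real.exp_pos (s - 1)).le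
  have hx₁0 : x₁ ≠ 0 := norm_pos_iff.1 (hx₁ ▸ Real.exp_pos _)
  have hx₁R : ‖x₁‖ ≤ R := by
    rw [hx₁, ← Real.exp_log hR]
    exact Real.exp_le_exp.2 (by linarith)
  have hlog₁ : Real.log ‖x₁‖ = s - 1 := by rw [hx₁, Real.log_exp]
  have hzero : ∀ (g : ℝ → ℝ), g s = 0 → ∀ x, ‖x‖ = R →
      Real.exp (ρ * Real.log ‖x‖) * g (Real.log ‖x‖) ≤ w x := by
    intro g hg x hx
    rw [hx, hg, mul_zero]
    exact (hw.pos x (norm_pos_iff.1 (hx ▸ hR)) hx.le).le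
  obtain ⟨A, B, hA, hAB⟩ : ∃ A B : ℝ, 0 < A ∧ ∀ S > 0,
      Real.exp (ρ * (s - 1)) * (A * S - B) ≤ w x₁ := by
    -- With `|x| ^ ρ g (log |x|)` the equation reads `k g' - g'' = b`; it is resonant for `k = 0`.
    rcases hk0.eq_or_lt with hk0 | hk0
    · refine ⟨b / 2, b / 2, by positivity, fun S hS => ?_⟩
      have h1 : ∀ t, HasDerivAt (fun t => b / 2 * ((s - t) * (t - (s - S))))
          (b / 2 * (-1 * (t - (s - S)) + (s - t) * 1)) t := fun t =>
        (((hasDerivAt_id' t).const_sub s).mul ((hasDerivAt_id' t).sub_const (s - S))).const_mul _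
      have h2 : ∀ t, HasDerivAt (fun t => b / 2 * (-1 * (t - (s - S)) + (s - t) * 1))
          (b / 2 * (-1 * 1 + -1 * 1)) t := fun t =>
        ((((hasDerivAt_id' t).sub_const (s - S)).const_mul (-1)).add
          (((hasDerivAt_id' t).const_sub s).mul_const 1)).const_mul _
      have h := hw.comparison ρ (T := s - S) (by fun_prop) h1 h2 (fun t ht => ?_)
        (hzero (fun t => b / 2 * ((s - t) * (t - (s - S)))) (by ring))
        (fun y hy hyR => ?_) hx₁0 hx₁R
      · rw [hlog₁] at h
        refine le_trans (le_of_eq ?_) h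
        ring
      · exact mul_nonpos_of_nonneg_of_nonpos (by positivity)
          (mul_nonpos_of_nonneg_of_nonpos (by linarith) (by linarith))
      · refine le_trans (le_of_eq ?_) (hsrc' y hy hyR)
        rw [hρ, show 2 * ρ + ((N : ℝ) - 2) = 0 by linarith]
        ring
    · refine ⟨b / k * (1 - Real.exp (-k)), b / k, ?_, fun S hS => ?_⟩
      · have : Real.exp (-k) < 1 := by
          rw [← Real.exp_zero]
          exact Real.exp_lt_exp.2 (by linarith)
        exact mul_pos (by positivity) (by linarith)
      have he : ∀ t, HasDerivAt (fun t => Real.exp (k * (t - s)))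
          (Real.exp (k * (t - s)) * k) t := fun t => by
        simpa using (((hasDerivAt_id' t).sub_const s).const_mul k).exp
      have h1 : ∀ t, HasDerivAt (fun t => b / k * (t - (s - S) - S * Real.exp (k * (t - s))))
          (b / k * (1 - S * (Real.exp (k * (t - s)) * k))) t := fun t =>
        (((hasDerivAt_id' t).sub_const (s - S)).sub ((he t).const_mul S)).const_mul _
      have h2 : ∀ t, HasDerivAt (fun t => b / k * (1 - S * (Real.exp (k * (t - s)) * k)))
          (b / k * -(S * (Real.exp (k * (t - s)) * k * k))) t := fun t =>
        ((((he t).mul_const k).const_mul S).const_sub 1).const_mul _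
      have h := hw.comparison ρ (T := s - S) (by fun_prop) h1 h2 (fun t ht => ?_)
        (hzero (fun t => b / k * (t - (s - S) - S * Real.exp (k * (t - s)))) (by simp))
        (fun y hy hyR => ?_) hx₁0 hx₁R
      · rw [hlog₁] at h
        refine le_trans (le_of_eq ?_) h
        rw [show k * (s - 1 - s) = -k by ring]
        ring
      · have : 0 < S * Real.exp (k * (t - s)) := by positivity
        exact mul_nonpos_of_nonneg_of_nonpos (by positivity) (by linarith)
      · refine le_trans (le_of_eq ?_) (hsrc' y hy hyR)
        rw [hρ, show 2 * ρ + ((N : ℝ) - 2) = -k by linarith]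
        field_simp
        ring
  set E := Real.exp (ρ * (s - 1)) with hE
  have hE0 : 0 < E := Real.exp_pos _
  have hw₁ := hw.pos x₁ hx₁0 hx₁R
  have h := hAB ((w x₁ / E + |B| + 1) / A) (by positivity)
  have h2 : E * (A * ((w x₁ / E + |B| + 1) / A) - B) = w x₁ + E * (|B| - B + 1) := by
    field_simp
    ring
  have h3 : 0 < E * (|B| - B + 1) := mul_pos hE0 (by linarith [le_abs_self B])
  linarith

/-! ### The characteristic roots -/

theorem hardyTauPlus_mul_add {N : ℕ} {μ : ℝ} (hμ : hardyMuZero N ≤ μ) :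
    hardyTauPlus N μ * (hardyTauPlus N μ + ((N : ℝ) - 2)) = μ := by
  have h := Real.sq_sqrt (sub_nonneg.2 hμ)
  have h0 : hardyMuZero N = -((N : ℝ) - 2) ^ 2 / 4 := rfl
  have : hardyTauPlus N μ * (hardyTauPlus N μ + ((N : ℝ) - 2)) =
      Real.sqrt (μ - hardyMuZero N) ^ 2 - ((N : ℝ) - 2) ^ 2 / 4 := by
    rw [hardyTauPlus]
    ring
  rw [this, h, h0]
  ring

theorem two_mul_hardyTauPlus_add (N : ℕ) (μ : ℝ) :
    2 * hardyTauPlus N μ + ((N : ℝ) - 2) = 2 * Real.sqrt (μ - hardyMuZero N) := by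
  rw [hardyTauPlus]
  ring

theorem hardyTauPlus_neg {N : ℕ} (hN : 3 ≤ N) {μ : ℝ} (hμ : μ < 0) : hardyTauPlus N μ < 0 := by
  have hN' : (3 : ℝ) ≤ N := by exact_mod_cast hN
  have : Real.sqrt (μ - hardyMuZero N) < ((N : ℝ) - 2) / 2 := by
    rw [Real.sqrt_lt' (by linarith), hardyMuZero]
    linarith
  rw [hardyTauPlus]
  linarith

theorem hardyTauPlus_nonneg {N : ℕ} {μ : ℝ} (hμ : 0 ≤ μ) : 0 ≤ hardyTauPlus N μ := by
  have : ((N : ℝ) - 2) / 2 ≤ Real.sqrt (μ - hardyMuZero N) := by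
    apply Real.le_sqrt_of_sq_le
    rw [hardyMuZero]
    linarith
  rw [hardyTauPlus]
  linarith

/-- The smaller root `τ₋(μ) = -(N-2) - τ₊(μ)` of `μ - τ (τ + N - 2) = 0`. -/
noncomputable def hardyTauMinus (N : ℕ) (μ : ℝ) : ℝ := -((N : ℝ) - 2) - hardyTauPlus N μ

/-! ### Nonexistence for the system -/

/-- A lower bound `z ≥ c |x| ^ β` and `ℒ_μ w ≥ z ^ s` give a source of order `|x| ^ (s β)`; the
factor `|x| ^ 2` makes the exponent `s β + 2` comparable with the roots. -/
theorem HasPowerLowerBound.source {N : ℕ} {μ R β s : ℝ} {w z : EuclideanSpace ℝ (Fin N) → ℝ}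
    (hz : HasPowerLowerBound R z β) (hs : 0 < s)
    (hwz : ∀ x, x ≠ 0 → ‖x‖ ≤ R → z x ^ s ≤ hardyOp μ w x) :
    ∃ a : ℝ, 0 < a ∧ ∀ x, x ≠ 0 → ‖x‖ ≤ R →
      a * Real.exp ((s * β + 2) * Real.log ‖x‖) ≤ ‖x‖ ^ 2 * hardyOp μ w x := by
  obtain ⟨c, hc, h⟩ := hz
  refine ⟨c ^ s, Real.rpow_pos_of_pos hc s, fun x hx hxR => ?_⟩
  have hn : 0 < ‖x‖ := norm_pos_iff.2 hx
  have h1 : (c * Real.exp (β * Real.log ‖x‖)) ^ s ≤ hardyOp μ w x :=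
    (Real.rpow_le_rpow (by positivity) (h x hx hxR) hs.le).trans (hwz x hx hxR)
  rw [Real.mul_rpow hc.le (Real.exp_pos _).le, ← Real.exp_mul] at h1
  have h2 : Real.exp (2 * Real.log ‖x‖) = ‖x‖ ^ 2 := by
    rw [two_mul, Real.exp_add, Real.exp_log hn, sq]
  calc c ^ s * Real.exp ((s * β + 2) * Real.log ‖x‖)
      = ‖x‖ ^ 2 * (c ^ s * Real.exp (β * Real.log ‖x‖ * s)) := by
        rw [← h2, show (s * β + 2) * Real.log ‖x‖ =
          2 * Real.log ‖x‖ + β * Real.log ‖x‖ * s by ring, Real.exp_add]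
        ring
    _ ≤ ‖x‖ ^ 2 * hardyOp μ w x := by gcongr

theorem IsStrictSupersolution.false_of_le_hardyTauMinus {N : ℕ} (hN : 0 < N) {μ R β s : ℝ}
    {w z : EuclideanSpace ℝ (Fin N) → ℝ} (hw : IsStrictSupersolution μ R w)
    (hμ : hardyMuZero N ≤ μ) (hz : HasPowerLowerBound R z β) (hs : 0 < s)
    (hwz : ∀ x, x ≠ 0 → ‖x‖ ≤ R → z x ^ s ≤ hardyOp μ w x)
    (hβ : s * β + 2 ≤ hardyTauMinus N μ) : False := by
  obtain ⟨a, ha, hsrc⟩ := hz.source hs hwz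
  have h := hardyTauPlus_mul_add hμ
  have h' := two_mul_hardyTauPlus_add N μ
  have h'' := Real.sqrt_nonneg (μ - hardyMuZero N)
  refine hw.false_of_source hN ?_ ?_ hβ ha hsrc
  · rw [hardyTauMinus]
    linarith
  · rw [hardyTauMinus]
    linarith

theorem IsStrictSupersolution.hasPowerLowerBound_transfer {N : ℕ} (hN : 0 < N) {μ R β s : ℝ}
    {w z : EuclideanSpace ℝ (Fin N) → ℝ} (hw : IsStrictSupersolution μ R w)
    (hμ : hardyMuZero N ≤ μ) (hz : HasPowerLowerBound R z β) (hs : 0 < s)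
    (hwz : ∀ x, x ≠ 0 → ‖x‖ ≤ R → z x ^ s ≤ hardyOp μ w x)
    (hβ : s * β + 2 < hardyTauPlus N μ) :
    hardyTauMinus N μ < s * β + 2 ∧ HasPowerLowerBound R w (s * β + 2) := by
  have hlt : hardyTauMinus N μ < s * β + 2 := by
    by_contra! h
    exact hw.false_of_le_hardyTauMinus hN hμ hz hs hwz h
  obtain ⟨a, ha, hsrc⟩ := hz.source hs hwz
  refine ⟨hlt, hw.hasPowerLowerBound_of_source ?_ ha hsrc⟩
  have h := hardyTauPlus_mul_add hμ
  have h2 := mul_pos (sub_pos.2 hβ) (sub_pos.2 hlt)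
  rw [hardyTauMinus] at h2
  linarith

theorem theorem1 (N : ℕ) (hN : 3 ≤ N)
    (Ω : Set (EuclideanSpace ℝ (Fin N))) (hΩ_open : IsOpen Ω) (hΩ_conn : IsConnected Ω)
    (hΩ_bdd : Bornology.IsBounded Ω) (hΩ_zero : (0 : EuclideanSpace ℝ (Fin N)) ∈ Ω)
    (μ₁ μ₂ p q : ℝ) (hμ₀ : hardyMuZero N ≤ μ₁) (hμ₁ : μ₁ < 0) (hμ₂ : 0 ≤ μ₂)
    (hp : 0 < p) (hq : 0 < q)
    (hpq :
      ((N : ℝ) + hardyTauPlus N μ₂) / (-hardyTauPlus N μ₁) ≤ q ∨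
      (2 / (-hardyTauPlus N μ₁) < q ∧
        q < ((N : ℝ) + hardyTauPlus N μ₂) / (-hardyTauPlus N μ₁) ∧
        (hardyMuZero N < μ₁ → hardyTauPlus N μ₁ * (p * q - 1) + 2 * p + 2 < 0) ∧
        (μ₁ = hardyMuZero N → hardyTauPlus N μ₁ * (p * q - 1) + 2 * p + 2 ≤ 0))) :
    ¬ ∃ u v : EuclideanSpace ℝ (Fin N) → ℝ, IsPositiveSupersolution Ω μ₁ μ₂ p q u v := by
  rintro ⟨u, v, huv⟩
  have hN0 : 0 < N := by omega
  obtain ⟨R, hR, hRΩ⟩ := Metric.nhds_basis_closedBall.mem_iff.1 (hΩ_open.mem_nhds hΩ_zero)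
  have hmem : ∀ x : EuclideanSpace ℝ (Fin N), x ≠ 0 → ‖x‖ ≤ R → x ∈ Ω \ {0} := fun x hx hxR =>
    ⟨hRΩ (by simpa using hxR), hx⟩
  have hopen : IsOpen (Ω \ {0}) := hΩ_open.sdiff isClosed_singleton
  have hu : IsStrictSupersolution μ₁ R u :=
    ⟨hR, fun x hx hxR => huv.contDiffOn_u.contDiffAt (hopen.mem_nhds (hmem x hx hxR)),
      fun x hx hxR => huv.pos_u x (hmem x hx hxR), fun x hx hxR =>
        (Real.rpow_pos_of_pos (huv.pos_v x (hmem x hx hxR)) p).trans_le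
          (huv.ineq_u x (hmem x hx hxR))⟩
  have hv : IsStrictSupersolution μ₂ R v :=
    ⟨hR, fun x hx hxR => huv.contDiffOn_v.contDiffAt (hopen.mem_nhds (hmem x hx hxR)),
      fun x hx hxR => huv.pos_v x (hmem x hx hxR), fun x hx hxR =>
        (Real.rpow_pos_of_pos (huv.pos_u x (hmem x hx hxR)) q).trans_le
          (huv.ineq_v x (hmem x hx hxR))⟩
  have hineq_u : ∀ x, x ≠ 0 → ‖x‖ ≤ R → v x ^ p ≤ hardyOp μ₁ u x := fun x hx hxR =>
    huv.ineq_u x (hmem x hx hxR)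
  have hineq_v : ∀ x, x ≠ 0 → ‖x‖ ≤ R → u x ^ q ≤ hardyOp μ₂ v x := fun x hx hxR =>
    huv.ineq_v x (hmem x hx hxR)
  have hμ₂' : hardyMuZero N ≤ μ₂ := by linarith
  have hτ₁ : hardyTauPlus N μ₁ < 0 := hardyTauPlus_neg hN hμ₁
  have hτ₂ : 0 ≤ hardyTauPlus N μ₂ := hardyTauPlus_nonneg hμ₂
  have hsqrt := two_mul_hardyTauPlus_add N μ₁
  have hbase : HasPowerLowerBound R u (hardyTauPlus N μ₁) :=
    hu.hasPowerLowerBound_root (hardyTauPlus_mul_add hμ₀) (hsqrt ▸ by positivity)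
  set τ := hardyTauPlus N μ₁ with hτ
  rcases hpq with h | ⟨h2, -, hlt, heq⟩
  · rw [div_le_iff₀ (by linarith)] at h
    refine hv.false_of_le_hardyTauMinus hN0 hμ₂' hbase hq hineq_v ?_
    rw [hardyTauMinus]
    linarith
  rw [div_lt_iff₀ (by linarith)] at h2
  have hτv : ∀ β ≤ τ, HasPowerLowerBound R u β → HasPowerLowerBound R v (q * β + 2) :=
    fun β hβ hβu => (hv.hasPowerLowerBound_transfer hN0 hμ₂' hβu hq hineq_v (by nlinarith)).2
  rcases hμ₀.eq_or_lt with hμ | hμ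
  -- In the critical case the roots coincide, and a single round trip reaches `τ₋(μ₁)`.
  · refine hu.false_of_le_hardyTauMinus hN0 hμ₀ (hτv τ le_rfl hbase) hp hineq_u ?_
    rw [hardyTauMinus, ← hτ]
    rw [← hμ, sub_self, Real.sqrt_zero] at hsqrt
    linarith [heq hμ.symm]
  · obtain ⟨δ, hδ⟩ : ∃ δ, δ = -(τ * (p * q - 1) + 2 * p + 2) := ⟨_, rfl⟩
    have hδ0 : 0 < δ := by linarith [hlt hμ]
    -- Since `τ < 0`, the assumption forces `p q > 1`, hence each round trip `u → v → u` lowers the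
    -- exponent by at least `δ`, while it has to stay above `τ₋(μ₁)`.
    have hpq1 : 0 < p * q - 1 := by
      by_contra! h
      nlinarith
    have hiter : ∀ k : ℕ, ∃ β, β ≤ τ - k * δ ∧ hardyTauMinus N μ₁ ≤ β ∧
        HasPowerLowerBound R u β := by
      intro k
      induction k with
      | zero =>
        refine ⟨τ, by simp, ?_, hbase⟩
        have := Real.sqrt_nonneg (μ₁ - hardyMuZero N)
        rw [hardyTauMinus, ← hτ]
        linarith
      | succ k ih =>
        obtain ⟨β, hβ, -, hβu⟩ := ih
        have hβτ : β ≤ τ := hβ.trans (sub_le_self _ (by positivity))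
        have hstep : p * (q * β + 2) + 2 ≤ β - δ := by nlinarith
        obtain ⟨h3, h4⟩ := hu.hasPowerLowerBound_transfer hN0 hμ₀ (hτv β hβτ hβu) hp hineq_u
          (by linarith)
        refine ⟨_, ?_, h3.le, h4⟩
        push_cast
        linarith
    obtain ⟨k, hk⟩ := exists_nat_gt ((τ - hardyTauMinus N μ₁) / δ)
    rw [div_lt_iff₀ hδ0] at hk
    obtain ⟨β, h3, h4, -⟩ := hiter k
    linarith
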